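/- Let $n \ge 1$. For a permutation $\pi = (\pi_1,\dots,\pi_n) \in S_n$ and $r \in \{1,\dots,n+1\}$, consider the following configuration $\pi^{(r)}$ of $n+1$ chips labeled $1,\dots,n+1$ on $\mathbb{Z}$. Put $\pi_i' = \pi_i$ if $\pi_i < r$ and $\pi_i' = \pi_i + 1$ if $\pi_i \ge r$; place the chips $\pi_1',\dots,\pi_n'$, in this order, at the sites $-\lfloor (n-1)/2\rfloor, \dots, -1, 0, 1, \dots, \lfloor n/2\rfloor$, and place the chip $r$ at the origin $0$. A toppling move chooses two chips $\alpha < \beta$ at a common site $i$ and moves $\alpha$ to $i-1$ and $\beta$ to $i+1$; moves are performed until no site holds two or more chips. The permutation $\pi$ is called $r$-toppleable if, starting from $\pi^{(r)}$ and whatever the choice of the moves, in the final configuration the chips read from left to right are $1,2,\dots,n+1$. It is called toppleable if it is $r$-toppleable for all $r \in \{1,\dots,n+1\}$. Let $t_r(n)$ be the number of $r$-toppleable permutations in $S_n$ and $t(n)$ the number of toppleable permutations in $S_n$. Let $a_{n,k}$ be the number of permutations $\pi \in S_n$ whose excedance set $\{i \in \{1,\dots,n\} : \pi_i > i\}$ is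 exactly $\{1,\dots,k\}$. Then $$t(n) = t_{\lfloor n/2\rfloor + 1}(n) = t_{\lfloor n/2\rfloor + 2}(n) = a_{n,\lfloor (n-1)/2\rfloor}.$$ -/

import Mathlib

/-!
Permutations of `{1, …, n}` are `Equiv.Perm (Fin n)`: the element `i : Fin n` stands for the
number `i + 1`, both as a position and as a value.  In the same way the `n + 1` chips, labelled
`1, …, n + 1`, are the elements of `Fin (n + 1)`, the chip `k` carrying the label `k + 1`.
-/

namespace Toppling

/-- A configuration of `N` labelled chips on the integer line: the site of each chip. -/
abbrev Config (N : ℕ) : Type := Fin N → ℤ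

/-- One toppling move: two chips `α < β` at the same site `i` are chosen, `α` moves to `i - 1`
and `β` moves to `i + 1`; all other chips stay. -/
def Topples {N : ℕ} (c c' : Config N) : Prop :=
  ∃ α β : Fin N, α < β ∧ c α = c β ∧
    c' = Function.update (Function.update c α (c α - 1)) β (c β + 1)

/-- The dynamics stops at `c`: no site holds two or more chips. -/
def IsStable {N : ℕ} (c : Config N) : Prop := Function.Injective c

/-- The initial configuration `π^(r)`, where `r` is the label of the chip `k`.
The chip `k` is placed at the origin.  The remaining chips are those of the form
`k.succAbove v` with `v : Fin n` (the values `≥ r` are shifted up by one); if `v = π i`, this chip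
is placed at the `i`-th of the sites `-⌊(n-1)/2⌋, …, ⌊n/2⌋`. -/
def initConfig {n : ℕ} (π : Equiv.Perm (Fin n)) (k : Fin (n + 1)) : Config (n + 1) :=
  Fin.insertNth k (0 : ℤ) (fun v : Fin n => ((π.symm v : ℕ) : ℤ) - (((n - 1) / 2 : ℕ) : ℤ))

/-- Some sequence of topplings starting at `π^(r)` stops at a configuration whose chips, read
from left to right, are `σ 0, σ 1, …, σ n`. -/
def IsOutcome {n : ℕ} (π : Equiv.Perm (Fin n)) (k : Fin (n + 1))
    (σ : Equiv.Perm (Fin (n + 1))) : Prop :=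
  ∃ c : Config (n + 1), Relation.ReflTransGen Topples (initConfig π k) c ∧ IsStable c ∧
    StrictMono (c ∘ σ)

/-- `𝒯(π, r) = σ`: the permutation read off from the final configuration is `σ`, whatever the
order in which the topplings are performed. -/
def TopplesTo {n : ℕ} (π : Equiv.Perm (Fin n)) (k : Fin (n + 1))
    (σ : Equiv.Perm (Fin (n + 1))) : Prop :=
  IsOutcome π k σ ∧ ∀ τ : Equiv.Perm (Fin (n + 1)), IsOutcome π k τ → τ = σ

/-- `π` is `r`-toppleable, for a label `r ∈ {1, …, n + 1}` (it is false for other `r`):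
`𝒯(π, r)` is the identity permutation. -/
def IsRToppleable {n : ℕ} (r : ℕ) (π : Equiv.Perm (Fin n)) : Prop :=
  ∃ k : Fin (n + 1), (k : ℕ) + 1 = r ∧ TopplesTo π k 1

/-- `π` is toppleable: it is `r`-toppleable for all `r ∈ {1, …, n + 1}`. -/
def IsToppleable {n : ℕ} (π : Equiv.Perm (Fin n)) : Prop :=
  ∀ r ∈ Finset.Icc 1 (n + 1), IsRToppleable r π

/-- `t_r(n)`, the number of `r`-toppleable permutations in `S_n`. -/
noncomputable def numRToppleable (r n : ℕ) : ℕ :=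
  Nat.card {π : Equiv.Perm (Fin n) // IsRToppleable r π}

/-- `t(n)`, the number of toppleable permutations in `S_n`. -/
noncomputable def numToppleable (n : ℕ) : ℕ :=
  Nat.card {π : Equiv.Perm (Fin n) // IsToppleable π}

/-- The excedance set of `π`, as a set of positions in `{1, …, n}`. -/
def excedanceSet {n : ℕ} (π : Equiv.Perm (Fin n)) : Set ℕ :=
  {p | ∃ i : Fin n, (i : ℕ) + 1 = p ∧ i < π i}

/-- `a_{n,k}`, the number of permutations in `S_n` whose excedance set is exactly
`{1, …, k}`. -/
noncomputable def numExcedance (n k : ℕ) : ℕ :=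
  Nat.card {π : Equiv.Perm (Fin n) // excedanceSet π = Set.Icc 1 k}

end Toppling

namespace Toppling

/-! Put a = ⌊(n-1)/2⌋ and b = ⌊n/2⌋. The invariant `Balanced` keeps at most two chips on every site,
so moves at different sites commute and the stable configuration is unique
(`Balanced.stable_unique`). It therefore suffices to follow one run.

The run is a sorting procedure: each chip on the sites 0, -1, …, -a in turn is pushed right through
the row of chips that starts at its site; at every meeting the larger chip goes on and the smaller
steps left (`reach_sweep`). The result is sorted exactly when simple bounds hold for the initial
lists (`sweep_sorted_iff`). In terms of π they confine each relabelled value to a band around its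
position (`topplesTo_one_iff_bounds`).

Relabelling raises a value by 0 or 1. If π itself lies in the band `InBand`, every r works;
conversely, for r = b + 1 and r = b + 2 the bounds already force `InBand`. Finally, at each position
only one of the two band inequalities is not automatic, and suitable reversals turn it into an
excedance or non-excedance condition (`card_inBand`). -/

/-! ### Confluence -/

/-- The number of chips at sites `≤ i`. -/
def countLE {N : ℕ} (c : Config N) (i : ℤ) : ℤ := ∑ x, if c x ≤ i then 1 else 0

theorem card_le_countLE_sub {N : ℕ} (c : Config N) (i : ℤ) (s : Finset (Fin N))
    (hs : ∀ x ∈ s, c x = i) : (s.card : ℤ) ≤ countLE c i - countLE c (i - 1) := by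
  have h : (s.card : ℤ) = ∑ x ∈ s, ((if c x ≤ i then 1 else 0) - if c x ≤ i - 1 then 1 else 0) := by
    rw [Finset.card_eq_sum_ones, Nat.cast_sum]
    refine Finset.sum_congr rfl fun x hx => ?_
    have := hs x hx
    simp [this]
  rw [h, countLE, countLE, ← Finset.sum_sub_distrib]
  refine Finset.sum_le_univ_sum_of_nonneg fun x => ?_
  split_ifs <;> omega

theorem countLE_topple {N : ℕ} {c : Config N} {α β : Fin N} (h : α ≠ β) (hc : c α = c β) (j : ℤ) :
    countLE (Function.update (Function.update c α (c α - 1)) β (c β + 1)) j =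
      countLE c j + (if j = c α - 1 then 1 else 0) - if j = c α then 1 else 0 := by
  rw [add_sub_assoc, ← sub_eq_iff_eq_add', countLE, countLE, ← Finset.sum_sub_distrib, Fintype.sum_eq_add α β h]
  · simp only [Function.update_self, Function.update_of_ne h, ← hc]
    split_ifs <;> omega
  · rintro x ⟨h1, h2⟩
    simp [h1, h2]

/-- All chips lie strictly right of `A` and not right of `B`, and on this window the number of
chips up to a site stays within one of its generic value. -/
structure Balanced {N : ℕ} (A B : ℤ) (c : Config N) : Prop where
  mem : ∀ x, A < c x ∧ c x ≤ B
  count : ∀ i, A ≤ i → i ≤ B → i - A - 1 ≤ countLE c i ∧ countLE c i ≤ i - A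

theorem Balanced.site_unique {N : ℕ} {A B : ℤ} {c : Config N} (hc : Balanced A B c)
    {α β γ : Fin N} (hαβ : α ≠ β) (h : c α = c β) (hγ : c γ = c α) : γ = α ∨ γ = β := by
  by_contra! hne
  have h3 := card_le_countLE_sub c (c α) {γ, α, β} (by simp [h, hγ])
  rw [Finset.card_eq_three.2 ⟨γ, α, β, hne.1, hne.2, hαβ, rfl⟩] at h3
  have := hc.mem α
  have := hc.count (c α) (by omega) (by omega)
  have := hc.count (c α - 1) (by omega) (by omega)
  push_cast at h3
  omega

/-- Two chips at a site i force the count to be maximal at i and minimal at i - 1; a move changes it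
by -1 and +1 exactly there. -/
theorem Balanced.topple {N : ℕ} {A B : ℤ} (hN : (N : ℤ) = B - A - 1) {c c' : Config N}
    (hc : Balanced A B c) (h : Topples c c') : Balanced A B c' := by
  obtain ⟨α, β, hlt, hαβ, rfl⟩ := h
  have h2 := card_le_countLE_sub c (c α) {α, β} (by simp [hαβ])
  rw [Finset.card_pair hlt.ne] at h2
  push_cast at h2
  have hα := hc.mem α
  have h3 := hc.count (c α) (by omega) (by omega)
  have h4 := hc.count (c α - 1) (by omega) (by omega)
  have hA : countLE c A = 0 := Finset.sum_eq_zero fun x _ => by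
    have := hc.mem x
    rw [if_neg (by omega)]
  have hB : countLE c B = N := by
    rw [countLE, Finset.sum_congr rfl fun x _ => if_pos (hc.mem x).2]
    simp
  -- The counts at the ends of the window are fixed, 0 at `A` and `N` at `B`, which leaves no room
  -- for a pair at the first or the last site.
  have h5 : c α - 1 ≠ A := fun h => by rw [h] at h2; omega
  have h6 : c α ≠ B := fun h => by rw [h] at h2 h4; omega
  constructor
  · intro x
    have := hc.mem x
    rcases eq_or_ne x β with rfl | hxβ
    · rw [Function.update_self]; omega
    rw [Function.update_of_ne hxβ]
    rcases eq_or_ne x α with rfl | hxα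
    · rw [Function.update_self]; omega
    rwa [Function.update_of_ne hxα]
  · intro i hi hi'
    rw [countLE_topple hlt.ne hαβ]
    have := hc.count i hi hi'
    split_ifs with h7 h8 h8
    · omega
    · subst h7; omega
    · subst h8; omega
    · omega

theorem Balanced.diamond {N : ℕ} {A B : ℤ} {c d e : Config N} (hc : Balanced A B c)
    (hd : Topples c d) (he : Topples c e) : d = e ∨ ∃ f, Topples d f ∧ Topples e f := by
  obtain ⟨α, β, hlt, hαβ, rfl⟩ := hd
  obtain ⟨γ, δ, hlt', hγδ, rfl⟩ := he
  by_cases h : c γ = c α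
  · left
    have h1 := hc.site_unique hlt.ne hαβ h
    have h2 := hc.site_unique hlt.ne hαβ (hγδ ▸ h)
    obtain ⟨rfl, rfl⟩ : γ = α ∧ δ = β := by
      rcases h1 with rfl | rfl <;> rcases h2 with rfl | rfl
      · exact absurd hlt' (lt_irrefl _)
      · exact ⟨rfl, rfl⟩
      · exact absurd hlt' hlt.asymm
      · exact absurd hlt' (lt_irrefl _)
    rfl
  · right
    have h1 : γ ≠ α := by rintro rfl; exact h rfl
    have h2 : γ ≠ β := by rintro rfl; exact h hαβ.symm
    have h3 : δ ≠ α := by rintro rfl; exact h hγδ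
    have h4 : δ ≠ β := by rintro rfl; exact h (hγδ.trans hαβ.symm)
    refine ⟨_, ⟨γ, δ, hlt', ?_, rfl⟩, α, β, hlt, ?_, ?_⟩
    · simp [h1, h2, h3, h4, hγδ]
    · simp [h1.symm, h2.symm, h3.symm, h4.symm, hαβ]
    · funext x
      simp only [Function.update_apply]
      split_ifs <;> simp_all

theorem IsStable.not_topples {N : ℕ} {c c' : Config N} (hc : IsStable c) : ¬ Topples c c' :=
  fun ⟨_, _, hlt, h, _⟩ => hlt.ne (hc h)

theorem Balanced.stable_unique {N : ℕ} {A B : ℤ} (hN : (N : ℤ) = B - A - 1) {c d e : Config N}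
    (hc : Balanced A B c) (hd : Relation.ReflTransGen Topples c d)
    (he : Relation.ReflTransGen Topples c e) (hd' : IsStable d) (he' : IsStable e) : d = e := by
  -- The diamond property needs balance, so it is built into the relation.
  let r : Config N → Config N → Prop := fun x y => Balanced A B x ∧ Topples x y
  have lift : ∀ {x}, Relation.ReflTransGen Topples c x →
      Relation.ReflTransGen r c x ∧ Balanced A B x := by
    intro x hx
    induction hx with
    | refl => exact ⟨.refl, hc⟩
    | tail _ h ih => exact ⟨ih.1.tail ⟨ih.2, h⟩, ih.2.topple hN h⟩
  have stuck : ∀ {x y}, IsStable x → Relation.ReflTransGen r x y → x = y := by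
    intro x y hx hxy
    rcases hxy.cases_head with h | ⟨z, hz, _⟩
    · exact h
    · exact absurd hz.2 hx.not_topples
  obtain ⟨f, h1, h2⟩ := Relation.church_rosser (r := r) (fun x y z hy hz => by
    rcases hy.1.diamond hy.2 hz.2 with rfl | ⟨w, h1, h2⟩
    · exact ⟨y, .refl, .refl⟩
    · exact ⟨w, .single ⟨hy.1.topple hN hy.2, h1⟩, .single ⟨hz.1.topple hN hz.2, h2⟩⟩)
    (lift hd).1 (lift he).1
  rw [stuck hd' h1, stuck he' h2]

theorem balanced_initConfig {n : ℕ} (a b : ℕ) (ha : (n - 1) / 2 = a) (hn : n = a + b + 1)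
    (π : Equiv.Perm (Fin n)) (k : Fin (n + 1)) :
    Balanced (-(a : ℤ) - 2) (b + 1) (initConfig π k) := by
  have hk : initConfig π k k = 0 := by simp [initConfig]
  have hv : ∀ v, initConfig π k (k.succAbove v) = ((π.symm v : ℕ) : ℤ) - a := fun v => by
    simp [initConfig, ha]
  constructor
  · intro x
    induction x using Fin.succAboveCases k with
    | x => rw [hk]; omega
    | p v => rw [hv]; have := (π.symm v).isLt; omega
  · intro i hi hi'
    have h : countLE (initConfig π k) i = (if 0 ≤ i then 1 else 0) + (min (i + a + 1) n).toNat := by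
      rw [countLE, Fin.sum_univ_succAbove _ k, hk]
      congr 1
      simp only [hv]
      rw [Equiv.sum_comp π.symm (fun p : Fin n => if ((p : ℕ) : ℤ) - a ≤ i then (1 : ℤ) else 0),
        Fin.sum_univ_eq_sum_range (fun p : ℕ => if (p : ℤ) - a ≤ i then (1 : ℤ) else 0),
        ← Finset.sum_filter, Finset.sum_const, nsmul_one]
      congr 1
      rw [← Finset.card_range (min (i + a + 1) n).toNat]
      congr 1
      ext p
      simp only [Finset.mem_filter, Finset.mem_range]
      omega
    rw [h]
    split_ifs <;> omega

/-! ### Simulation -/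

/-- `x` moves rightwards through the list: at every entry the larger of the two goes on and the
smaller one stays.  The result is the element that comes out and the list left behind. -/
def bump {α : Type*} [LinearOrder α] : α → List α → α × List α
  | x, [] => (x, [])
  | x, q :: Q => ((bump (max x q) Q).1, min x q :: (bump (max x q) Q).2)

/-- The entries of the first list are bumped through the second one, one after the other. -/
def sweep {α : Type*} [LinearOrder α] : List α → List α → List α × List α
  | [], Q => ([], Q)
  | x :: P, Q => ((bump x Q).1 :: (sweep P (bump x Q).2).1, (sweep P (bump x Q).2).2)

section lists

variable {α : Type*} [LinearOrder α]

theorem max_cons_min_perm (x q : α) (Q : List α) :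
    (max x q :: min x q :: Q).Perm (x :: q :: Q) := by
  rcases le_total x q with h | h
  · rw [max_eq_right h, min_eq_left h]; exact .swap ..
  · rw [max_eq_left h, min_eq_right h]

theorem bump_perm (x : α) (Q : List α) : ((bump x Q).1 :: (bump x Q).2).Perm (x :: Q) := by
  induction Q generalizing x with
  | nil => rfl
  | cons q Q ih =>
    exact (List.Perm.swap ..).trans <| ((ih _).cons _).trans <|
      (List.Perm.swap ..).trans <| max_cons_min_perm x q Q

theorem length_bump (x : α) (Q : List α) : (bump x Q).2.length = Q.length := by
  simpa using (bump_perm x Q).length_eq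

theorem append_bump_perm (x : α) (P Q : List α) :
    ((bump x Q).1 :: (P ++ (bump x Q).2)).Perm (x :: P ++ Q) :=
  List.perm_middle.symm.trans <| ((bump_perm x Q).append_left P).trans List.perm_middle

theorem le_bump (x : α) (Q : List α) : ∀ y ∈ x :: Q, y ≤ (bump x Q).1 := by
  induction Q generalizing x with
  | nil => simp [bump]
  | cons q Q ih =>
    have h := ih (max x q)
    have h1 := h _ List.mem_cons_self
    intro y hy
    rcases List.mem_cons.1 hy with rfl | hy
    · exact (le_max_left _ _).trans h1
    rcases List.mem_cons.1 hy with rfl | hy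
    · exact (le_max_right _ _).trans h1
    · exact h y (List.mem_cons_of_mem _ hy)

theorem length_sweep (P Q : List α) :
    (sweep P Q).1.length = P.length ∧ (sweep P Q).2.length = Q.length := by
  induction P generalizing Q with
  | nil => simp [sweep]
  | cons x P ih => simp [sweep, ih, length_bump]

end lists

/-- The chips of the list are placed at the sites `s, s + d, s + 2 d, …`. -/
def Placed {N : ℕ} (c : Config N) (d : ℤ) : ℤ → List (Fin N) → Prop
  | _, [] => True
  | s, q :: Q => c q = s ∧ Placed c d (s + d) Q

theorem placed_iff {N : ℕ} {c : Config N} {d s : ℤ} {Q : List (Fin N)} :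
    Placed c d s Q ↔ ∀ (i : ℕ) (h : i < Q.length), c Q[i] = s + i * d := by
  induction Q generalizing s with
  | nil => simp [Placed]
  | cons q Q ih =>
    rw [Placed, ih]
    constructor
    · rintro ⟨h1, h2⟩ (_ | i) h
      · simp [h1]
      · rw [List.getElem_cons_succ, h2]; push_cast; ring
    · intro h
      refine ⟨(h 0 (by simp)).trans (by simp), fun i hi => ?_⟩
      have := h (i + 1) (by simpa using hi)
      rw [List.getElem_cons_succ] at this
      rw [this]; push_cast; ring

theorem Placed.congr {N : ℕ} {c c' : Config N} {d s : ℤ} {Q : List (Fin N)} (h : Placed c d s Q)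
    (hc : ∀ y ∈ Q, c' y = c y) : Placed c' d s Q := by
  rw [placed_iff] at h ⊢
  intro i hi
  rw [hc _ (List.getElem_mem hi), h i hi]

/-- Toppling at s, s + 1, … in turn carries out `bump`; the row left behind has moved one site to
the left, where the next chip of the sweep is waiting. -/
theorem reach_bump {N : ℕ} {c : Config N} {s : ℤ} {x : Fin N} {Q : List (Fin N)}
    (hnd : (x :: Q).Nodup) (hx : c x = s) (hQ : Placed c 1 s Q) :
    ∃ c', Relation.ReflTransGen Topples c c' ∧ (∀ y ∉ x :: Q, c' y = c y) ∧
      c' (bump x Q).1 = s + Q.length ∧ Placed c' 1 (s - 1) (bump x Q).2 := by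
  induction Q generalizing c s x with
  | nil => exact ⟨c, .refl, fun _ _ => rfl, by simp [bump, hx], trivial⟩
  | cons q Q ih =>
    have hxq : x ≠ q := by rintro rfl; simp at hnd
    have hlt : min x q < max x q := min_lt_max.2 hxq
    have hnd' : (min x q :: max x q :: Q).Nodup :=
      ((List.Perm.swap ..).trans (max_cons_min_perm x q Q)).nodup_iff.2 hnd
    have hmin : c (min x q) = s := by rcases min_choice x q with h | h <;> simp [h, hx, hQ.1]
    have hmax : c (max x q) = s := by rcases max_choice x q with h | h <;> simp [h, hx, hQ.1]
    have hQn : ∀ y, y ≠ x → y ≠ q → y ≠ max x q ∧ y ≠ min x q := fun y h1 h2 => by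
      rcases max_choice x q with h | h <;> rcases min_choice x q with h' | h' <;>
        simp [h, h', h1, h2]
    set c1 := Function.update (Function.update c (min x q) (c (min x q) - 1)) (max x q)
      (c (max x q) + 1) with hc1
    have hoff : ∀ y, y ≠ x → y ≠ q → c1 y = c y := fun y h1 h2 => by
      rw [hc1, Function.update_of_ne (hQn y h1 h2).1, Function.update_of_ne (hQn y h1 h2).2]
    have hstep : Topples c c1 := ⟨_, _, hlt, by rw [hmin, hmax], by rw [hc1, hmin, hmax]⟩
    obtain ⟨c', h1, h2, h3, h4⟩ := ih (c := c1) (s := s + 1) (x := max x q) (List.nodup_cons.1 hnd').2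
      (by rw [hc1, Function.update_self, hmax])
      (hQ.2.congr fun y hy => hoff y (by rintro rfl; simp [hy] at hnd)
        (by rintro rfl; simp [hy] at hnd))
    refine ⟨c', .head hstep h1, fun y hy => ?_, ?_, ?_, ?_⟩
    · simp only [List.mem_cons, not_or] at hy
      rw [h2, hoff y hy.1 hy.2.1]
      simp [(hQn y hy.1 hy.2.1).1, hy.2.2]
    · rw [bump, h3]; push_cast [List.length_cons]; ring
    · rw [h2 _ (List.nodup_cons.1 hnd').1, hc1, Function.update_of_ne hlt.ne, Function.update_self,
        hmin]
    · rw [show s - 1 + 1 = s + 1 - 1 by ring]; exact h4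

theorem reach_sweep {N : ℕ} {c : Config N} {s : ℤ} {P Q : List (Fin N)}
    (hnd : (P ++ Q).Nodup) (hP : Placed c (-1) s P) (hQ : Placed c 1 s Q) :
    ∃ c', Relation.ReflTransGen Topples c c' ∧ (∀ y ∉ P ++ Q, c' y = c y) ∧
      Placed c' (-1) (s + Q.length) (sweep P Q).1 ∧ Placed c' 1 (s - P.length) (sweep P Q).2 := by
  induction P generalizing c s Q with
  | nil => exact ⟨c, .refl, fun _ _ => rfl, trivial, by simpa [sweep] using hQ⟩
  | cons x P ih =>
    have hperm := append_bump_perm x P Q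
    have hnd' := hperm.nodup_iff.2 hnd
    have hxP : ∀ y ∈ P, y ∉ x :: Q := fun y hy hy' => by
      have h : (P ++ x :: Q).Nodup := List.nodup_middle.2 hnd
      exact List.disjoint_of_nodup_append h hy hy'
    have hxQ : (x :: Q).Nodup := by
      have h : (P ++ x :: Q).Nodup := List.nodup_middle.2 hnd
      exact (List.nodup_append.1 h).2.1
    obtain ⟨c1, h1, h2, h3, h4⟩ := reach_bump hxQ hP.1 hQ
    obtain ⟨c', h5, h6, h7, h8⟩ := ih (c := c1) (s := s - 1) (List.nodup_cons.1 hnd').2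
      (hP.2.congr fun y hy => h2 y (hxP y hy)) h4
    refine ⟨c', h1.trans h5, fun y hy => ?_, ⟨?_, ?_⟩, ?_⟩
    · have hy' := mt hperm.mem_iff.1 hy
      rw [h6 y (fun h => hy' (List.mem_cons_of_mem _ h)), h2 y]
      intro h
      apply hy
      simp only [List.mem_cons, List.cons_append, List.mem_append] at h ⊢
      tauto
    · rw [h6 _ (List.nodup_cons.1 hnd').1, h3]
    · rw [length_bump] at h7
      rwa [show s + (Q.length : ℤ) + -1 = s - 1 + Q.length by ring]
    · rw [sweep, List.length_cons]
      rwa [show s - ((P.length + 1 : ℕ) : ℤ) = s - 1 - P.length by push_cast; ring]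

/-! ### When the sweep sorts -/

theorem forall_getElem_cons {α : Type*} {p : ℕ → α → Prop} {x : α} {L : List α} :
    (∀ (i : ℕ) (h : i < (x :: L).length), p i (x :: L)[i]) ↔
      p 0 x ∧ ∀ (i : ℕ) (h : i < L.length), p (i + 1) L[i] := by
  constructor
  · intro h
    exact ⟨h 0 (by simp), fun i hi => h (i + 1) (by simpa using hi)⟩
  · rintro ⟨h1, h2⟩ (_ | i) h
    · exact h1
    · exact h2 i (by simpa using h)

theorem length_le_of_nodup_of_lt {M m : ℕ} {L : List (Fin M)} (hL : L.Nodup)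
    (h : ∀ x ∈ L, (x : ℕ) < m) : L.length ≤ m := by
  have h1 : (L.map Fin.val).Nodup := hL.map Fin.val_injective
  have h2 : L.map Fin.val ⊆ List.range m := by
    intro y hy
    obtain ⟨x, hx, rfl⟩ := List.mem_map.1 hy
    exact List.mem_range.2 (h x hx)
  simpa using (h1.subperm h2).length_le

/-- The travelling element at entry i is the maximum of `x` and the earlier entries, hence at least
`t i`; taking the minimum with it does not affect the bound. A general `t` lets the induction shift
indices. -/
theorem le_bump_iff {M : ℕ} (t : ℕ → ℕ) (x : Fin M) (Q : List (Fin M))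
    (h : ∀ i < Q.length, ∃ y ∈ x :: Q.take i, t i ≤ y) :
    (∀ (i : ℕ) (h : i < (bump x Q).2.length), t i ≤ (bump x Q).2[i]) ↔
      ∀ (i : ℕ) (h : i < Q.length), t i ≤ Q[i] := by
  induction Q generalizing x t with
  | nil => simp [bump]
  | cons q Q ih =>
    have h0 : t 0 ≤ x := by simpa using h 0 (by simp)
    simp only [bump]
    rw [forall_getElem_cons (p := fun i (y : Fin M) => t i ≤ y),
      forall_getElem_cons (p := fun i (y : Fin M) => t i ≤ y),
      ih (fun i => t (i + 1)) (max x q)]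
    · refine and_congr_left fun _ => ?_
      rcases min_choice x q with h | h <;> rw [h]
      have := min_eq_left_iff.1 h
      have : (x : ℕ) ≤ q := this
      constructor <;> intro <;> omega
    · intro i hi
      obtain ⟨y, hy, hy'⟩ := h (i + 1) (by simpa using hi)
      simp only [List.take_succ_cons, List.mem_cons] at hy
      rcases hy with rfl | rfl | hy
      · exact ⟨_, List.mem_cons_self, hy'.trans (Fin.le_def.1 (le_max_left _ _))⟩
      · exact ⟨_, List.mem_cons_self, hy'.trans (Fin.le_def.1 (le_max_right _ _))⟩
      · exact ⟨y, List.mem_cons_of_mem _ hy, hy'⟩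

theorem eq_iff_le_of_nodup {M : ℕ} {Q : List (Fin M)} (hQ : Q.Nodup)
    (h : ∀ x ∈ Q, (x : ℕ) < Q.length) :
    (∀ (i : ℕ) (h : i < Q.length), (Q[i] : ℕ) = i) ↔
      ∀ (i : ℕ) (h : i < Q.length), i ≤ (Q[i] : ℕ) := by
  refine ⟨fun h i hi => (h i hi).ge, fun hle => ?_⟩
  let f : Fin Q.length → Fin Q.length := fun i => ⟨Q[i], h _ (List.getElem_mem _)⟩
  have hf : Function.Injective f := fun i j hij => by
    have : Q[i] = Q[j] := Fin.ext (Fin.mk.inj_iff.1 hij)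
    exact Fin.ext ((hQ.getElem_inj_iff).1 this)
  -- A permutation that is termwise at least the identity has the same sum, so it equals the
  -- identity.
  have hsum : ∑ i : Fin Q.length, (i : ℕ) = ∑ i, (f i : ℕ) :=
    (Equiv.sum_comp (Equiv.ofBijective f hf.bijective_of_finite) (fun i => (i : ℕ))).symm
  have := (Finset.sum_eq_sum_iff_of_le fun (i : Fin Q.length) _ => hle i i.2).1 hsum
  exact fun i hi => (this ⟨i, hi⟩ (Finset.mem_univ _)).symm

/-- Each bump preserves the condition on `Q` and emits the maximum of `x :: Q`, which must be the
largest remaining label. The bounds on `P` ensure this by keeping that label out of the tail of `P`.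
-/
theorem sweep_sorted_iff {M N : ℕ} {P Q : List (Fin M)} (hnd : (P ++ Q).Nodup)
    (hN : P.length + Q.length = N) (h : ∀ x ∈ P ++ Q, (x : ℕ) < N) :
    ((∀ (j : ℕ) (h : j < (sweep P Q).1.length), ((sweep P Q).1[j] : ℕ) + j + 1 = N) ∧
      ∀ (i : ℕ) (h : i < (sweep P Q).2.length), ((sweep P Q).2[i] : ℕ) = i) ↔
    (∀ (j : ℕ) (h : j < P.length), (P[j] : ℕ) + j + 1 ≤ N) ∧
      ∀ (i : ℕ) (h : i < Q.length), i ≤ (Q[i] : ℕ) := by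
  induction P generalizing Q N with
  | nil =>
    simp only [List.length_nil, zero_add] at hN
    subst hN
    simpa [sweep] using eq_iff_le_of_nodup hnd h
  | cons x P ih =>
    have hperm := append_bump_perm x P Q
    have hnd' := List.nodup_cons.1 (hperm.nodup_iff.2 hnd)
    have hlt : ∀ y ∈ (bump x Q).1 :: (P ++ (bump x Q).2), (y : ℕ) < N := fun y hy =>
      h y (hperm.mem_iff.1 hy)
    have hxQ : (x :: Q).Nodup := by
      have h : (P ++ x :: Q).Nodup := List.nodup_middle.2 hnd
      exact (List.nodup_append.1 h).2.1
    obtain ⟨N, rfl⟩ : ∃ N', N = N' + 1 := ⟨P.length + Q.length, by rw [← hN]; simp; omega⟩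
    -- Pigeonhole: i + 1 distinct labels cannot all be below i.
    have hQ := le_bump_iff id x Q fun i hi => by
      by_contra! hcon
      have := length_le_of_nodup_of_lt
        (hxQ.sublist (List.Sublist.cons_cons x (List.take_sublist i Q))) hcon
      simp at this
      omega
    simp only [id] at hQ
    simp only [sweep]
    rw [forall_getElem_cons (p := fun j (y : Fin M) => (y : ℕ) + j + 1 = N + 1),
      forall_getElem_cons (p := fun j (y : Fin M) => (y : ℕ) + j + 1 ≤ N + 1), ← hQ]
    have key : ((bump x Q).1 : ℕ) = N → _ := fun hx =>
      ih (N := N) hnd'.2 (by simp at hN; rw [length_bump]; omega) fun y hy => by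
        have h1 := hlt y (List.mem_cons_of_mem _ hy)
        have h2 : (y : ℕ) ≠ (bump x Q).1 := fun h => hnd'.1 (Fin.ext h ▸ hy)
        omega
    have e1 : ∀ y j : ℕ, y + (j + 1) + 1 = N + 1 ↔ y + j + 1 = N := by omega
    have e2 : ∀ y j : ℕ, y + (j + 1) + 1 ≤ N + 1 ↔ y + j + 1 ≤ N := by omega
    simp only [e1, e2]
    constructor
    · rintro ⟨⟨hx, h1⟩, h2⟩
      obtain ⟨h3, h4⟩ := (key (by omega)).1 ⟨h1, h2⟩
      exact ⟨⟨h x (by simp), h3⟩, h4⟩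
    · rintro ⟨⟨-, h1⟩, h2⟩
      have hx : ((bump x Q).1 : ℕ) = N := by
        by_contra hne
        have hlt' := hlt _ List.mem_cons_self
        have := length_le_of_nodup_of_lt (m := N) hnd fun y hy => by
          rw [List.cons_append, List.mem_cons, List.mem_append] at hy
          by_cases hyP : y ∈ P
          · obtain ⟨j, hj, rfl⟩ := List.mem_iff_getElem.1 hyP
            have := h1 j hj
            omega
          · have : (y : ℕ) ≤ (bump x Q).1 := le_bump x Q y (List.mem_cons.2 (by tauto))
            omega
        simp at this hN
        omega
      obtain ⟨h3, h4⟩ := (key hx).2 ⟨h1, h2⟩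
      exact ⟨⟨by omega, h3⟩, h4⟩

/-! ### The criterion for `r`-toppleability -/

theorem topplesTo_one_iff {n : ℕ} {π : Equiv.Perm (Fin n)} {k : Fin (n + 1)} {c : Config (n + 1)}
    (hn : 1 ≤ n) (h : Relation.ReflTransGen Topples (initConfig π k) c) (hc : IsStable c) :
    TopplesTo π k 1 ↔ StrictMono c := by
  have huniq : ∀ d, Relation.ReflTransGen Topples (initConfig π k) d → IsStable d → d = c :=
    fun d hd hd' => (balanced_initConfig ((n - 1) / 2) (n / 2) rfl (by omega) π k).stable_unique
      (by push_cast; omega) hd h hd' hc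
  constructor
  · rintro ⟨⟨d, hd, hd', hmono⟩, -⟩
    rw [← huniq d hd hd']
    exact hmono
  · intro hmono
    refine ⟨⟨c, h, hc, hmono⟩, ?_⟩
    rintro τ ⟨d, hd, hd', hτ⟩
    rw [huniq d hd hd'] at hτ
    have h1 : StrictMono τ := fun x y hxy => hmono.lt_iff_lt.1 (hτ hxy)
    exact DFunLike.coe_injective <| (h1.range_inj strictMono_id).1
      (by rw [τ.surjective.range_eq, Set.range_id])

theorem strictMono_iff_eq_id {N : ℕ} {c : Config N} {M : Fin N → Fin N}
    (h : StrictMono (c ∘ M)) : StrictMono c ↔ ∀ i, M i = i := by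
  constructor
  · intro hc
    have h1 : StrictMono M := fun x y hxy => hc.lt_iff_lt.1 (h hxy)
    exact congrFun <| (h1.range_inj strictMono_id).1
      (by rw [(Finite.surjective_of_injective h1.injective).range_eq, Set.range_id])
  · intro hM
    rwa [show M = id from funext hM] at h

theorem isStable_of_strictMono_comp {N : ℕ} {c : Config N} {M : Fin N → Fin N}
    (h : StrictMono (c ∘ M)) : IsStable c := by
  intro x y hxy
  have hM : Function.Surjective M := Finite.surjective_of_injective h.injective.of_comp
  obtain ⟨x, rfl⟩ := hM x
  obtain ⟨y, rfl⟩ := hM y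
  exact congrArg M (h.injective hxy)

theorem topplesTo_one_iff_lists {n a b : ℕ} (ha : a = (n - 1) / 2) (hb : b = n / 2) (hn : 1 ≤ n)
    {π : Equiv.Perm (Fin n)} {k : Fin (n + 1)} {P Q : List (Fin (n + 1))} (hnd : (P ++ Q).Nodup)
    (hPl : P.length = a + 1) (hQl : Q.length = b + 1)
    (hP : Placed (initConfig π k) (-1) 0 P) (hQ : Placed (initConfig π k) 1 0 Q) :
    TopplesTo π k 1 ↔ (∀ (j : ℕ) (h : j < P.length), (P[j] : ℕ) + j ≤ n) ∧
      ∀ (i : ℕ) (h : i < Q.length), i ≤ (Q[i] : ℕ) := by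
  obtain ⟨c, hreach, -, h1, h2⟩ := reach_sweep hnd hP hQ
  have hsort := sweep_sorted_iff (N := n + 1) hnd (by omega) fun x _ => x.isLt
  obtain ⟨hl1, hl2⟩ := length_sweep P Q
  rw [placed_iff] at h1 h2
  set P' := (sweep P Q).1
  set Q' := (sweep P Q).2
  -- The final configuration read from left to right: `Q'` starts at -a - 1, `P'` descends from b +
  -- 1, and the only gap is the site b - a.
  let M : Fin (n + 1) → Fin (n + 1) := fun i =>
    if h : (i : ℕ) < Q'.length then Q'[(i : ℕ)] else P'[n - i]'(by omega)
  have hM : ∀ i : Fin (n + 1), c (M i) =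
      if (i : ℕ) < Q'.length then (i : ℤ) - a - 1 else (i : ℤ) - a := by
    intro i
    by_cases h : (i : ℕ) < Q'.length
    · simp only [M, dif_pos h, if_pos h, h2]
      omega
    · simp only [M, dif_neg h, if_neg h, h1]
      omega
  have hmono : StrictMono (c ∘ M) := by
    intro x y hxy
    have : (x : ℕ) < y := hxy
    simp only [Function.comp, hM]
    split_ifs <;> omega
  rw [topplesTo_one_iff hn hreach (isStable_of_strictMono_comp hmono), strictMono_iff_eq_id hmono]
  simp only [Nat.add_le_add_iff_right] at hsort
  rw [← hsort]
  constructor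
  · intro h
    constructor
    · intro j hj
      have h3 := h ⟨n - j, by omega⟩
      simp only [M] at h3
      rw [dif_neg (by omega)] at h3
      simp only [show n - (n - j) = j by omega] at h3
      rw [h3]
      show n - j + j + 1 = n + 1
      omega
    · intro i hi
      have h3 := h ⟨i, by omega⟩
      simp only [M] at h3
      rw [dif_pos hi] at h3
      rw [h3]
  · rintro ⟨h3, h4⟩ i
    apply Fin.ext
    by_cases h : (i : ℕ) < Q'.length
    · simp only [M, dif_pos h, h4]
    · simp only [M, dif_neg h]
      have := h3 (n - i) (by omega)
      omega

theorem topplesTo_one_iff_bounds {n a b : ℕ} (ha : a = (n - 1) / 2) (hb : b = n / 2) (hn : 1 ≤ n)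
    (π : Equiv.Perm (Fin n)) (k : Fin (n + 1)) :
    TopplesTo π k 1 ↔ ∀ i : Fin n, (i : ℕ) ≤ k.succAbove (π i) + a ∧
      (k.succAbove (π i) : ℕ) ≤ i + b + 1 := by
  have hn' : n = a + b + 1 := by omega
  have hv : ∀ i, initConfig π k (k.succAbove (π i)) = ((i : ℕ) : ℤ) - a := fun v => by
    simp [initConfig, ha]
  have hk : initConfig π k k = 0 := by simp [initConfig]
  -- Index a sits at the origin. Its chip heads the left list and `k` heads the right one, where the
  -- bound on entry 0 is vacuous.
  let p : Fin (a + 1) → Fin (n + 1) := fun j => k.succAbove (π ⟨a - j, by omega⟩)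
  let q : Fin b → Fin (n + 1) := fun j => k.succAbove (π ⟨a + 1 + j, by omega⟩)
  have hnd : (List.ofFn p ++ k :: List.ofFn q).Nodup := by
    rw [List.nodup_middle, List.nodup_cons, List.nodup_append]
    refine ⟨?_, ?_, ?_, ?_⟩
    · simp [p, q, List.mem_ofFn, Fin.succAbove_ne]
    · refine List.nodup_ofFn.2 fun i j hij => ?_
      have := Fin.mk.inj_iff.1 (π.injective (Fin.succAbove_right_injective hij))
      omega
    · refine List.nodup_ofFn.2 fun i j hij => ?_
      have := Fin.mk.inj_iff.1 (π.injective (Fin.succAbove_right_injective hij))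
      omega
    · intro x hx y hy hxy
      obtain ⟨i, rfl⟩ := List.mem_ofFn.1 hx
      obtain ⟨j, rfl⟩ := List.mem_ofFn.1 hy
      have := Fin.mk.inj_iff.1 (π.injective (Fin.succAbove_right_injective hxy))
      omega
  rw [topplesTo_one_iff_lists ha hb hn hnd (by simp) (by simp)]
  · rw [forall_getElem_cons (p := fun i (y : Fin (n + 1)) => i ≤ (y : ℕ))]
    simp only [List.getElem_ofFn, List.length_ofFn, p, q]
    constructor
    · rintro ⟨h1, -, h2⟩ i
      rcases le_or_gt (i : ℕ) a with hi | hi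
      · have h3 := h1 (a - i) (by omega)
        simp only [show a - (a - (i : ℕ)) = i by omega, Fin.eta] at h3
        omega
      · have h3 := h2 (i - (a + 1)) (by omega)
        simp only [show a + 1 + ((i : ℕ) - (a + 1)) = i by omega, Fin.eta] at h3
        omega
    · intro h
      refine ⟨fun j hj => ?_, Nat.zero_le _, fun j hj => ?_⟩
      · have := (h ⟨a - j, by omega⟩).2
        simp only at this
        omega
      · have := (h ⟨a + 1 + j, by omega⟩).1
        simp only at this
        omega
  · rw [placed_iff]
    intro i hi
    rw [List.length_ofFn] at hi
    simp only [List.getElem_ofFn, p, hv]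
    omega
  · refine ⟨hk, ?_⟩
    rw [placed_iff]
    intro i hi
    simp only [List.getElem_ofFn, q, hv]
    push_cast
    ring

/-! ### Counting -/

/-- The permutation moves no entry by more than `⌊(n-1)/2⌋` to the left or `⌊n/2⌋` to the right. -/
def InBand {n : ℕ} (π : Equiv.Perm (Fin n)) : Prop :=
  ∀ i : Fin n, (i : ℕ) ≤ π i + (n - 1) / 2 ∧ (π i : ℕ) ≤ i + n / 2

theorem val_succAbove {n : ℕ} (k : Fin (n + 1)) (v : Fin n) :
    (k.succAbove v : ℕ) = if (v : ℕ) < k then (v : ℕ) else v + 1 := by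
  unfold Fin.succAbove
  simp only [Fin.lt_def, Fin.val_castSucc]
  split_ifs <;> rfl

theorem InBand.topplesTo_one {n : ℕ} (hn : 1 ≤ n) {π : Equiv.Perm (Fin n)} (h : InBand π)
    (k : Fin (n + 1)) : TopplesTo π k 1 := by
  rw [topplesTo_one_iff_bounds rfl rfl hn]
  intro i
  have := h i
  rw [val_succAbove]
  split_ifs <;> omega

/-- Unshifted values are at most ⌊n/2⌋, so their upper bound is automatic; shifted ones are at least
⌊n/2⌋, so their lower bound is. The other bound is the one given. -/
theorem isRToppleable_iff_inBand {n r : ℕ} (hn : 1 ≤ n) (hr : r = n / 2 + 1 ∨ r = n / 2 + 2)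
    (π : Equiv.Perm (Fin n)) : IsRToppleable r π ↔ InBand π := by
  constructor
  · rintro ⟨k, hk, h⟩ i
    rw [topplesTo_one_iff_bounds rfl rfl hn] at h
    have := h i
    rw [val_succAbove] at this
    split_ifs at this <;> omega
  · intro h
    exact ⟨⟨r - 1, by omega⟩, by simp only; omega, h.topplesTo_one hn _⟩

theorem isToppleable_iff_inBand {n : ℕ} (hn : 1 ≤ n) (π : Equiv.Perm (Fin n)) :
    IsToppleable π ↔ InBand π := by
  constructor
  · intro h
    exact (isRToppleable_iff_inBand hn (.inl rfl) π).1
      (h _ (Finset.mem_Icc.2 ⟨by omega, by omega⟩))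
  · intro h r hr
    rw [Finset.mem_Icc] at hr
    exact ⟨⟨r - 1, by omega⟩, by simp only; omega, h.topplesTo_one hn _⟩

theorem excedanceSet_eq_Icc_iff {n a : ℕ} (ha : a ≤ n) (π : Equiv.Perm (Fin n)) :
    excedanceSet π = Set.Icc 1 a ↔ ∀ i : Fin n, i < π i ↔ (i : ℕ) < a := by
  constructor
  · intro h i
    have h1 : (i : ℕ) + 1 ∈ excedanceSet π ↔ (i : ℕ) + 1 ∈ Set.Icc 1 a := by rw [h]
    rw [Set.mem_Icc] at h1
    have h2 : (i : ℕ) + 1 ∈ excedanceSet π ↔ i < π i :=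
      ⟨fun ⟨j, hj, hj'⟩ => by obtain rfl : j = i := Fin.ext (by omega); exact hj',
        fun h => ⟨i, rfl, h⟩⟩
    rw [← h2, h1]
    omega
  · intro h
    ext p
    constructor
    · rintro ⟨i, rfl, hi⟩
      have := (h i).1 hi
      exact ⟨by omega, by omega⟩
    · rintro ⟨h1, h2⟩
      exact ⟨⟨p - 1, by omega⟩, by simp only; omega, (h _).2 (by simp only; omega)⟩

/-- The involution reversing the first `a` and the last `n - a` elements of `Fin n`. -/
def blockRev (n a : ℕ) (ha : a ≤ n) : Equiv.Perm (Fin n) :=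
  Function.Involutive.toPerm
    (fun j => if h : (j : ℕ) < a then ⟨a - 1 - j, by omega⟩ else ⟨n - 1 + a - j, by omega⟩) fun j => by
    apply Fin.ext
    by_cases h : (j : ℕ) < a
    · have h' : a - 1 - (j : ℕ) < a := by omega
      simp only [dif_pos h, dif_pos h']
      omega
    · have h' : ¬ n - 1 + a - (j : ℕ) < a := by omega
      simp only [dif_neg h, dif_neg h']
      omega

theorem val_blockRev {n a : ℕ} (ha : a ≤ n) (j : Fin n) :
    (blockRev n a ha j : ℕ) = if (j : ℕ) < a then a - 1 - (j : ℕ) else n - 1 + a - j := by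
  change ((if h : (j : ℕ) < a then (⟨a - 1 - j, by omega⟩ : Fin n)
    else ⟨n - 1 + a - j, by omega⟩ : Fin n) : ℕ) = _
  split_ifs <;> rfl

theorem card_inBand {n : ℕ} (hn : 1 ≤ n) :
    Nat.card {π : Equiv.Perm (Fin n) // InBand π} = numExcedance n ((n - 1) / 2) := by
  have ha : (n - 1) / 2 ≤ n := by omega
  -- Reverse the values, and the positions within each block. On the first block an excedance is
  -- then the upper band inequality; on the second a non-excedance is the lower one.
  refine Nat.card_congr (Equiv.subtypeEquiv
    (Equiv.equivCongr (blockRev n ((n - 1) / 2) ha) Fin.revPerm) fun π => ?_)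
  rw [excedanceSet_eq_Icc_iff ha]
  refine (blockRev n ((n - 1) / 2) ha).forall_congr fun i => ?_
  have hi := val_blockRev ha i
  simp only [Equiv.equivCongr_apply_apply, Equiv.symm_apply_apply, Fin.revPerm_apply, Fin.lt_def,
    Fin.val_rev]
  have := i.isLt
  have := (π i).isLt
  rw [hi]
  split_ifs <;> omega

end Toppling

theorem mainTheorem1 (n : ℕ) (hn : 1 ≤ n) :
    Toppling.numToppleable n = Toppling.numRToppleable (n / 2 + 1) n ∧
    Toppling.numToppleable n = Toppling.numRToppleable (n / 2 + 2) n ∧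
    Toppling.numToppleable n = Toppling.numExcedance n ((n - 1) / 2) := by
  have h : Toppling.numToppleable n = Nat.card {π : Equiv.Perm (Fin n) // Toppling.InBand π} :=
    Nat.card_congr (Equiv.subtypeEquivRight (Toppling.isToppleable_iff_inBand hn))
  rw [h]
  exact ⟨(Nat.card_congr (Equiv.subtypeEquivRight
      (Toppling.isRToppleable_iff_inBand hn (.inl rfl)))).symm,
    (Nat.card_congr (Equiv.subtypeEquivRight
      (Toppling.isRToppleable_iff_inBand hn (.inr rfl)))).symm, Toppling.card_inBand hn⟩
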